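/- An ideal on a nonempty set $X$ is a family $\mathcal I\subseteq\mathcal P(X)$ with $X\notin\mathcal I$ that is closed under subsets and finite unions and contains all finite subsets of $X$. For ideals $\mathcal J$ on $Y$ and $\mathcal I$ on $X$, write $\mathcal J\le_K\mathcal I$ (Katětov order) if there is $f:X\to Y$ with $f^{-1}[A]\in\mathcal I$ for every $A\in\mathcal J$. For a countable ordinal $\beta\ge 2$, equip $\omega^\beta+1=[0,\omega^\beta]$ (ordinal exponentiation) with the order topology and let $\mathrm{conv}_\beta$ be the ideal on $\omega^\beta+1$ of all sets that can be covered by the ranges of finitely many convergent sequences in $\omega^\beta+1$. For a countable limit ordinal $\alpha$, put $$\mathrm{conv}_{<\alpha}=\{A\subseteq\omega^\alpha+1 : A\cap\omega^\beta\in\mathrm{conv}_\beta \text{ for all } 2\le\beta<\alpha\}.$$ Let $\alpha$ be a countable limit ordinal (in particular $\alpha\neq 0$). 1. $\mathrm{conv}_{<\alpha}$ is an ideal on $\omega^\alpha+1$ and it is a greatest lower bound of $\{\mathrm{conv}_\beta : 2\le\beta<\alpha\}$ in the Katětov order, i.e. (a) $\mathrm{conv}_{<\alpha}\le_K\mathrm{conv}_\beta$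 whenever $2\le\beta<\alpha$; (b) for every ideal $\mathcal I$ on any nonempty set, if $\mathcal I\le_K\mathrm{conv}_\beta$ for all $2\le\beta<\alpha$, then $\mathcal I\le_K\mathrm{conv}_{<\alpha}$. 2. $\mathrm{conv}_\alpha\le_K\mathrm{conv}_{<\alpha}$ and $\mathrm{conv}_{<\alpha}\not\le_K\mathrm{conv}_\alpha$. Consequently $\mathrm{conv}_\alpha$ is not a greatest lower bound of $\{\mathrm{conv}_\beta : 2\le\beta<\alpha\}$: some ideal lies Katětov-below every $\mathrm{conv}_\beta$, $2\le\beta<\alpha$, but not below $\mathrm{conv}_\alpha$. -/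

import Mathlib

open scoped Ordinal Topology

universe u v

/-- `I` is an ideal on the set `X`: a proper family of subsets, closed under finite unions and
subsets, which contains all finite sets. -/
structure IsIdealOn {X : Type*} (I : Set (Set X)) : Prop where
  empty_mem : ∅ ∈ I
  univ_notMem : Set.univ ∉ I
  union_mem : ∀ A B : Set X, A ∈ I → B ∈ I → A ∪ B ∈ I
  subset_mem : ∀ A B : Set X, A ⊆ B → B ∈ I → A ∈ I
  finite_mem : ∀ A : Set X, A.Finite → A ∈ I

/-- `J ≤_K I` (Katětov order), for `J` a family of subsets of `Y` and `I` one of subsets of `X`. -/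
def KatetovLE {X Y : Type*} (J : Set (Set Y)) (I : Set (Set X)) : Prop :=
  ∃ f : X → Y, ∀ A ∈ J, f ⁻¹' A ∈ I

/-- `conv(X)`: the subsets of the topological space `X` that are covered by the ranges of finitely
many convergent sequences of `X`. -/
def convFamily (X : Type*) [TopologicalSpace X] : Set (Set X) :=
  {A | ∃ (k : ℕ) (d : Fin k → ℕ → X),
    (∀ i, ∃ x, Filter.Tendsto (d i) Filter.atTop (𝓝 x)) ∧ A ⊆ ⋃ i, Set.range (d i)}

/-- The space `ω ^ α + 1`, i.e. the set of all ordinals below `ω ^ α + 1`. Its topology, inherited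
from the ordinals, is the order topology. -/
abbrev OmegaPowSucc (α : Ordinal) : Type _ := Set.Iio (ω ^ α + 1)

/-- `conv_α`. -/
def convOrd (α : Ordinal) : Set (Set (OmegaPowSucc α)) := convFamily (OmegaPowSucc α)

/-- `conv_{<α}`: the sets `A ⊆ ω ^ α + 1` with `A ∩ ω ^ β ∈ conv_β` for all `2 ≤ β < α`.
The set `A ∩ ω ^ β` is read as a set of ordinals and then as a subset of `ω ^ β + 1`. -/
def convLT (α : Ordinal) : Set (Set (OmegaPowSucc α)) :=
  {A | ∀ β : Ordinal, 2 ≤ β → β < α →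
    ((↑) : OmegaPowSucc β → Ordinal) ⁻¹'
      (((↑) : OmegaPowSucc α → Ordinal) '' A ∩ Set.Iio (ω ^ β)) ∈ convOrd β}

/-!
Let `f` be a Katětov reduction of `conv(Y)` to `conv(X)`, and call `y` a cluster value of `f` at
`x` if `f` takes values arbitrarily close to `y` at points `w ≠ x` arbitrarily close to `x`. Sets
covered by finitely many convergent sequences have only finitely many accumulation points.
Therefore each `y` is a cluster value at only finitely many points, and an induction on `ρ` shows
that, with finitely many exceptions, `f` has a cluster value of Cantor–Bendixson rank at least `ρ`
at every point of rank at least `ρ`.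

If in addition `f` reduces `conv_{<α}`, its cluster values are at most `ω ^ β` for some `β < α`,
again with finitely many exceptions: otherwise infinitely many points have cluster values tending
to `ω ^ α`, and sequences converging to these cluster values form together a set in `conv_{<α}`
whose preimage has infinitely many accumulation points. Since `ω ^ α + 1` has infinitely many
points of rank at least `β + 1`, while points of rank at least `β + 1` in `ω ^ α + 1` are at least
`ω ^ (β + 1)`, the two facts contradict each other for `X = ω ^ α + 1`.
-/

open Filter Set

section ConvFamily

variable {X Y : Type*} [TopologicalSpace X] [TopologicalSpace Y] {A B : Set X}

theorem mem_convFamily_of_subset (hB : B ∈ convFamily X) (h : A ⊆ B) : A ∈ convFamily X := by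
  obtain ⟨k, d, hd, hBd⟩ := hB
  exact ⟨k, d, hd, h.trans hBd⟩

theorem empty_mem_convFamily : (∅ : Set X) ∈ convFamily X :=
  ⟨0, Fin.elim0, fun i => i.elim0, empty_subset _⟩

theorem range_mem_convFamily {s : ℕ → X} {x : X} (hs : Tendsto s atTop (𝓝 x)) :
    range s ∈ convFamily X :=
  ⟨1, fun _ => s, fun _ => ⟨x, hs⟩, subset_iUnion (fun _ : Fin 1 => range s) 0⟩

theorem singleton_mem_convFamily (x : X) : {x} ∈ convFamily X := by
  simpa only [range_const] using range_mem_convFamily (tendsto_const_nhds (x := x))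

theorem union_mem_convFamily (hA : A ∈ convFamily X) (hB : B ∈ convFamily X) :
    A ∪ B ∈ convFamily X := by
  obtain ⟨k, d, hd, hAd⟩ := hA
  obtain ⟨l, e, he, hBe⟩ := hB
  refine ⟨k + l, Fin.append d e, Fin.addCases (by simpa using hd) (by simpa using he), ?_⟩
  refine union_subset (fun x hx => ?_) fun x hx => ?_
  · obtain ⟨i, hi⟩ := mem_iUnion.1 (hAd hx)
    exact mem_iUnion.2 ⟨Fin.castAdd l i, by simpa using hi⟩
  · obtain ⟨i, hi⟩ := mem_iUnion.1 (hBe hx)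
    exact mem_iUnion.2 ⟨Fin.natAdd k i, by simpa using hi⟩

theorem biUnion_mem_convFamily {ι : Type*} {t : Set ι} (ht : t.Finite) {A : ι → Set X}
    (hA : ∀ i ∈ t, A i ∈ convFamily X) : ⋃ i ∈ t, A i ∈ convFamily X := by
  induction t, ht using Set.Finite.induction_on with
  | empty => simpa only [biUnion_empty] using empty_mem_convFamily
  | insert _ _ ih =>
    rw [biUnion_insert]
    exact union_mem_convFamily (hA _ (mem_insert _ _))
      (ih fun i hi => hA i (mem_insert_of_mem _ hi))

theorem finite_mem_convFamily (hA : A.Finite) : A ∈ convFamily X := by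
  simpa only [biUnion_of_singleton] using
    biUnion_mem_convFamily hA fun x _ => singleton_mem_convFamily x

theorem image_mem_convFamily {g : X → Y} (hg : Continuous g) (hA : A ∈ convFamily X) :
    g '' A ∈ convFamily Y := by
  obtain ⟨k, d, hd, hAd⟩ := hA
  refine ⟨k, fun i => g ∘ d i, fun i => ?_, ?_⟩
  · obtain ⟨x, hx⟩ := hd i
    exact ⟨g x, (hg.tendsto x).comp hx⟩
  · simpa only [range_comp, image_iUnion] using image_mono hAd

theorem image_mem_convFamily_iff {g : X → Y} {r : Y → X} (hg : Continuous g) (hr : Continuous r)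
    (hrg : Function.LeftInverse r g) : g '' A ∈ convFamily Y ↔ A ∈ convFamily X := by
  refine ⟨fun h => ?_, image_mem_convFamily hg⟩
  simpa only [hrg.image_image] using image_mem_convFamily hr h

theorem mem_convFamily_of_forall_finite_diff (hA : A.Countable) {x : X}
    (h : ∀ U ∈ 𝓝 x, (A \ U).Finite) : A ∈ convFamily X := by
  by_cases hfin : A.Finite
  · exact finite_mem_convFamily hfin
  have : Countable A := hA
  have : Infinite A := infinite_coe_iff.2 hfin
  obtain ⟨e⟩ := nonempty_equiv_of_countable (α := ℕ) (β := A)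
  have he : Tendsto (fun n => (e n : X)) atTop (𝓝 x) := fun U hU => by
    rw [← Nat.cofinite_eq_atTop, mem_map, mem_cofinite]
    exact ((h U hU).preimage (Subtype.val_injective.comp e.injective).injOn).subset
      fun n hn => ⟨(e n).2, hn⟩
  exact mem_convFamily_of_subset (range_mem_convFamily he) fun a ha => ⟨e.symm ⟨a, ha⟩, by simp⟩

theorem iUnion_range_mem_convFamily {x : X} {U : ℕ → Set X} (hU : (𝓝 x).HasAntitoneBasis U)
    {s : ℕ → ℕ → X} (hs : ∀ n, Tendsto (s n) atTop (𝓝 x)) (hsU : ∀ n k, s n k ∈ U n) :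
    ⋃ n, range (s n) ∈ convFamily X := by
  refine mem_convFamily_of_forall_finite_diff (countable_iUnion fun n => countable_range _)
    (x := x) fun V hV => ?_
  obtain ⟨m, hm⟩ := hU.mem_iff.1 hV
  choose N hN using fun n => eventually_atTop.1 ((hs n).eventually hV)
  refine ((finite_Iio m).biUnion fun n _ => (finite_Iio (N n)).image (s n)).subset ?_
  rintro z ⟨hz, hzV⟩
  obtain ⟨n, k, rfl⟩ := mem_iUnion.1 hz
  have hnm : n < m := not_le.1 fun hmn => hzV (hm (hU.antitone hmn (hsU n k)))
  exact mem_iUnion₂.2 ⟨n, hnm, k, not_le.1 fun hk => hzV (hN n k hk), rfl⟩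

end ConvFamily

section DerivedSet

variable {X : Type*} [TopologicalSpace X] {A : Set X}

theorem derivedSet_eq_empty_of_finite [T1Space X] (hA : A.Finite) : derivedSet A = ∅ :=
  eq_empty_of_forall_notMem fun x hx => accPt_iff_frequently_nhdsNE.1 hx
    (hA.eventually_cofinite_notMem.filter_mono (nhdsNE_le_cofinite x))

theorem derivedSet_iUnion_of_finite {ι : Type*} [Finite ι] (A : ι → Set X) :
    derivedSet (⋃ i, A i) = ⋃ i, derivedSet (A i) := by
  ext x
  rw [← not_iff_not]
  simp only [mem_iUnion, mem_derivedSet, accPt_iff_frequently_nhdsNE, not_exists, not_frequently,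
    eventually_all]

theorem derivedSet_range_subset_of_tendsto [T2Space X] {s : ℕ → X} {l : X}
    (hs : Tendsto s atTop (𝓝 l)) : derivedSet (range s) ⊆ {l} := by
  intro x hx
  by_contra hxl
  obtain ⟨U, hU, V, hV, hUV⟩ := Filter.disjoint_iff.1 (disjoint_nhds_nhds.2 hxl)
  have hfin : (U ∩ range s).Finite := by
    have hsV : {n | s n ∉ V}.Finite := by
      have := hs.eventually_mem hV
      rwa [← Nat.cofinite_eq_atTop, eventually_cofinite] at this
    refine (hsV.image s).subset ?_
    rintro _ ⟨hnU, n, rfl⟩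
    exact ⟨n, disjoint_left.1 hUV hnU, rfl⟩
  have hxU : x ∈ derivedSet (U ∩ range s) := AccPt.nhds_inter hx hU
  rwa [derivedSet_eq_empty_of_finite hfin] at hxU

theorem finite_derivedSet_of_mem_convFamily [T2Space X] (hA : A ∈ convFamily X) :
    (derivedSet A).Finite := by
  obtain ⟨k, d, hd, hAd⟩ := hA
  choose l hl using hd
  refine (finite_range l).subset ((derivedSet_mono _ _ hAd).trans ?_)
  rw [derivedSet_iUnion_of_finite]
  exact iUnion_subset fun i x hx => ⟨i, (derivedSet_range_subset_of_tendsto (hl i) hx).symm⟩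

theorem notMem_convFamily_of_injective [T2Space X] {x : ℕ → X} (hx : Function.Injective x)
    (hxA : ∀ n, x n ∈ derivedSet A) : A ∉ convFamily X := fun hA =>
  (infinite_range_of_injective hx).mono (range_subset_iff.2 hxA)
    (finite_derivedSet_of_mem_convFamily hA)

end DerivedSet

section CantorBendixson

variable {X Y : Type*} [TopologicalSpace X] [TopologicalSpace Y]

/-- The `ρ`-th Cantor–Bendixson derivative of the space `X`. In contrast with
`CantorBendixson.iteratedDerivedSet univ ρ`, the universe of `ρ` is independent of that of `X`. -/
def cbDerivative (X : Type*) [TopologicalSpace X] (ρ : Ordinal.{u}) : Set X :=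
  {x | ∀ σ < ρ, x ∈ derivedSet (cbDerivative X σ)}
termination_by ρ

theorem mem_cbDerivative_iff {ρ : Ordinal.{u}} {x : X} :
    x ∈ cbDerivative X ρ ↔ ∀ σ < ρ, x ∈ derivedSet (cbDerivative X σ) := by
  rw [cbDerivative, mem_ofPred_eq]

theorem cbDerivative_zero : cbDerivative X (0 : Ordinal.{u}) = univ :=
  eq_univ_of_forall fun _ => mem_cbDerivative_iff.2 fun _ hσ => absurd hσ not_lt_zero

theorem cbDerivative_antitone : Antitone (cbDerivative.{u} X) := fun _ _ h _ hx =>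
  mem_cbDerivative_iff.2 fun σ hσ => mem_cbDerivative_iff.1 hx σ (hσ.trans_le h)

theorem preimage_cbDerivative_of_isOpenEmbedding {e : X → Y} (he : Topology.IsOpenEmbedding e)
    (ρ : Ordinal.{u}) : e ⁻¹' cbDerivative Y ρ = cbDerivative X ρ := by
  induction ρ using WellFoundedLT.induction with
  | ind ρ ih =>
    ext x
    rw [mem_preimage, mem_cbDerivative_iff, mem_cbDerivative_iff]
    refine forall₂_congr fun σ hσ => ?_
    rw [← ih σ hσ, mem_derivedSet, mem_derivedSet, ← comap_principal, he.accPt_comap_iff]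

end CantorBendixson

theorem exists_seq_tendsto_of_mapClusterPt {X Y : Type*} [TopologicalSpace Y]
    [FirstCountableTopology Y] {f : X → Y} {l : Filter X} [l.IsCountablyGenerated] {y : Y}
    (h : MapClusterPt y l f) {W : Set Y} (hW : W ∈ 𝓝 y) :
    ∃ s : ℕ → X, Tendsto s atTop l ∧ Tendsto (f ∘ s) atTop (𝓝 y) ∧ ∀ k, f (s k) ∈ W := by
  obtain ⟨s, hfs, hs⟩ := MapClusterPt.exists_seq_tendsto h
  obtain ⟨N, hN⟩ := eventually_atTop.1 (hfs.eventually hW)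
  exact ⟨fun k => s (k + N), hs.comp (tendsto_add_atTop_nat N),
    hfs.comp (tendsto_add_atTop_nat N), fun k => hN _ (Nat.le_add_left _ _)⟩

theorem exists_forall_frequently_inter_nonempty {X Y : Type*} [TopologicalSpace Y]
    [CompactSpace Y] {ι : Type*} [Preorder ι] [IsDirectedOrder ι] [Nonempty ι] {l : Filter X}
    {S : ι → X → Set Y} (hS : Antitone S) (h : ∀ i, ∃ᶠ w in l, (S i w).Nonempty) :
    ∃ y, ∀ i, ∀ V ∈ 𝓝 y, ∃ᶠ w in l, (S i w ∩ V).Nonempty := by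
  by_contra! hcon
  suffices ∃ i, ∀ᶠ w in l, S i w ∩ univ = ∅ by
    obtain ⟨i, hi⟩ := this
    exact h i (hi.mono fun w hw => by rwa [inter_univ, ← not_nonempty_iff_eq_empty] at hw)
  refine isCompact_univ.induction_on (p := fun T => ∃ i, ∀ᶠ w in l, S i w ∩ T = ∅)
    ?_ ?_ ?_ fun y _ => ?_
  · exact ⟨Classical.arbitrary ι, Eventually.of_forall fun w => inter_empty _⟩
  · rintro T T' hTT' ⟨i, hi⟩
    exact ⟨i, hi.mono fun w hw => subset_eq_empty (inter_subset_inter_right _ hTT') hw⟩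
  · rintro T T' ⟨i, hi⟩ ⟨j, hj⟩
    obtain ⟨k, hik, hjk⟩ := exists_ge_ge i j
    refine ⟨k, hi.mp (hj.mono fun w hwj hwi => ?_)⟩
    rw [inter_union_distrib_left, union_empty_iff]
    exact ⟨subset_eq_empty (inter_subset_inter_left _ (hS hik w)) hwi,
      subset_eq_empty (inter_subset_inter_left _ (hS hjk w)) hwj⟩
  · obtain ⟨i, V, hV, hVl⟩ := hcon y
    exact ⟨V, mem_nhdsWithin_of_mem_nhds hV, i, by
      simpa only [not_frequently, not_nonempty_iff_eq_empty] using hVl⟩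

section Reductions

variable {X Y : Type*} [TopologicalSpace X] [TopologicalSpace Y] {f : X → Y}

theorem exists_seq_preimage_iUnion_range_notMem_convFamily [T2Space X]
    [FirstCountableTopology X] [FirstCountableTopology Y] {x : ℕ → X} (hx : Function.Injective x)
    {y : ℕ → Y} (hxy : ∀ n, MapClusterPt (y n) (𝓝[≠] x n) f) {W : ℕ → Set Y}
    (hW : ∀ n, W n ∈ 𝓝 (y n)) :
    ∃ t : ℕ → ℕ → Y, (∀ n, Tendsto (t n) atTop (𝓝 (y n))) ∧ (∀ n k, t n k ∈ W n) ∧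
      f ⁻¹' (⋃ n, range (t n)) ∉ convFamily X := by
  choose s hs hfs hsW using fun n => exists_seq_tendsto_of_mapClusterPt (hxy n) (hW n)
  refine ⟨fun n => f ∘ s n, hfs, hsW, notMem_convFamily_of_injective hx fun n => ?_⟩
  exact accPt_iff_frequently_nhdsNE.2
    ((hs n).frequently (Frequently.of_forall fun k => mem_iUnion.2 ⟨n, k, rfl⟩))

theorem mapClusterPt_nhdsNE_of_frequently [T1Space X] {x : X} {y : Y}
    (h : ∀ V ∈ 𝓝 y, ∃ᶠ w in 𝓝[≠] x, ∃ z ∈ V, MapClusterPt z (𝓝 w) f) :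
    MapClusterPt y (𝓝[≠] x) f := by
  refine mapClusterPt_iff_frequently.2 fun V hV hcon => ?_
  have hVfar : ∀ᶠ w in 𝓝[≠] x, ∀ᶠ s in 𝓝 w, f s ∉ V := by
    filter_upwards [eventually_eventually_nhdsWithin.2 hcon, self_mem_nhdsWithin] with w hw hwx
    rwa [isOpen_compl_singleton.nhdsWithin_eq hwx] at hw
  obtain ⟨w, ⟨z, hz, hzw⟩, hw⟩ :=
    ((h _ (interior_mem_nhds.2 hV)).and_eventually hVfar).exists
  exact mapClusterPt_iff_frequently.1 hzw V (mem_interior_iff_mem_nhds.1 hz) hw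

/-- The function `f` witnesses `KatetovLE J I`. -/
def IsKatetovReduction {X Y : Type*} (f : X → Y) (J : Set (Set Y)) (I : Set (Set X)) : Prop :=
  ∀ A ∈ J, f ⁻¹' A ∈ I

/-- The points that are accumulation points of some fibre of `f`. For a Katětov reduction between
`conv` ideals they form the finite exceptional set outside of which `f` behaves like a
finite-to-one map. -/
def fiberAccPts {X Y : Type*} [TopologicalSpace X] (f : X → Y) : Set X :=
  {x | ∃ c, x ∈ derivedSet (f ⁻¹' {c})}

theorem eventually_ne_of_notMem_fiberAccPts {X Y : Type*} [TopologicalSpace X] {f : X → Y} {x : X}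
    (hx : x ∉ fiberAccPts f) (y : Y) :
    ∀ᶠ w in 𝓝[≠] x, f w ≠ y :=
  not_frequently.1 fun h => hx ⟨y, accPt_iff_frequently_nhdsNE.2 h⟩

namespace IsKatetovReduction

variable [T2Space X]

theorem finite_fiberAccPts [SeqCompactSpace Y]
    (hf : IsKatetovReduction f (convFamily Y) (convFamily X)) : (fiberAccPts f).Finite := by
  by_contra hinf
  let x := Set.Infinite.natEmbedding _ hinf
  choose c hc using fun n => (x n).2
  obtain ⟨y, φ, hφ, hy⟩ := SeqCompactSpace.tendsto_subseq c
  refine notMem_convFamily_of_injective (x := fun n => (x (φ n) : X))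
    (Subtype.val_injective.comp (x.injective.comp hφ.injective)) (fun n => ?_)
    (hf _ (range_mem_convFamily hy))
  exact derivedSet_mono _ _ (preimage_mono (singleton_subset_iff.2 (mem_range_self n))) (hc (φ n))

variable [FirstCountableTopology X] [FirstCountableTopology Y]

theorem finite_setOf_mapClusterPt (hf : IsKatetovReduction f (convFamily Y) (convFamily X))
    (y : Y) : {x | MapClusterPt y (𝓝[≠] x) f}.Finite := by
  by_contra hinf
  let x := Set.Infinite.natEmbedding _ hinf
  obtain ⟨U, hU⟩ := (𝓝 y).exists_antitone_basis
  obtain ⟨t, ht, htU, htX⟩ := exists_seq_preimage_iUnion_range_notMem_convFamily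
    (Subtype.val_injective.comp x.injective) (fun n => (x n).2) hU.mem
  exact htX (hf _ (iUnion_range_mem_convFamily hU ht htU))

theorem eventually_not_mapClusterPt [T1Space Y]
    (hf : IsKatetovReduction f (convFamily Y) (convFamily X))
    {x : X} (hx : x ∉ fiberAccPts f) (y : Y) :
    ∀ᶠ w in 𝓝[≠] x, ¬ MapClusterPt y (𝓝 w) f := by
  filter_upwards [eventually_ne_of_notMem_fiberAccPts hx y,
    (hf.finite_setOf_mapClusterPt y).eventually_cofinite_notMem.filter_mono
      (nhdsNE_le_cofinite x)] with w hw hwy hwy'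
  rw [← pure_sup_nhdsNE, MapClusterPt, map_sup, clusterPt_sup, map_pure] at hwy'
  rcases hwy' with h | h
  · rw [← principal_singleton, ← mem_closure_iff_clusterPt, closure_singleton] at h
    exact hw h.symm
  · exact hwy h

theorem exists_mapClusterPt_forall_mem_derivedSet [CompactSpace Y] [T1Space Y] {ι : Type*}
    [Preorder ι] [IsDirectedOrder ι] [Nonempty ι]
    (hf : IsKatetovReduction f (convFamily Y) (convFamily X))
    {D : ι → Set Y} (hD : Antitone D) {x : X} (hx : x ∉ fiberAccPts f)
    (h : ∀ i, ∃ᶠ w in 𝓝[≠] x, ∃ z ∈ D i, MapClusterPt z (𝓝 w) f) :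
    ∃ y, MapClusterPt y (𝓝[≠] x) f ∧ ∀ i, y ∈ derivedSet (D i) := by
  obtain ⟨y, hy⟩ := exists_forall_frequently_inter_nonempty
    (S := fun i w => {z ∈ D i | MapClusterPt z (𝓝 w) f})
    (fun i j hij w z hz => ⟨hD hij hz.1, hz.2⟩) h
  refine ⟨y, mapClusterPt_nhdsNE_of_frequently fun V hV => ?_, fun i => ?_⟩
  · exact (hy (Classical.arbitrary ι) V hV).mono fun w ⟨z, hz, hzV⟩ => ⟨z, hzV, hz.2⟩
  · refine accPt_iff_nhds.2 fun V hV => ?_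
    obtain ⟨w, ⟨z, hz, hzV⟩, hw⟩ :=
      ((hy i V hV).and_eventually (hf.eventually_not_mapClusterPt hx y)).exists
    exact ⟨z, ⟨hzV, hz.1⟩, fun h => hw (h ▸ hz.2)⟩

theorem exists_mapClusterPt_mem_cbDerivative [CompactSpace Y] [T1Space Y]
    (hf : IsKatetovReduction f (convFamily Y) (convFamily X)) {ρ : Ordinal.{u}}
    (hρ : ρ ≠ 0) {x : X} (hx : x ∉ fiberAccPts f) (hxρ : x ∈ cbDerivative X ρ) :
    ∃ y, MapClusterPt y (𝓝[≠] x) f ∧ y ∈ cbDerivative Y ρ := by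
  induction ρ using WellFoundedLT.induction generalizing x with
  | ind ρ ih =>
  have : Nonempty (Iio ρ) := ⟨⟨0, pos_iff_ne_zero.2 hρ⟩⟩
  have hfreq (σ : Iio ρ) :
      ∃ᶠ w in 𝓝[≠] x, ∃ z ∈ cbDerivative Y (σ : Ordinal), MapClusterPt z (𝓝 w) f := by
    have hxσ := accPt_iff_frequently_nhdsNE.1 (mem_cbDerivative_iff.1 hxρ σ σ.2)
    refine (hxσ.and_eventually (hf.finite_fiberAccPts.eventually_cofinite_notMem.filter_mono
      (nhdsNE_le_cofinite x))).mono fun w ⟨hwσ, hw⟩ => ?_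
    by_cases hσ : (σ : Ordinal) = 0
    · refine ⟨f w, by simp only [hσ, cbDerivative_zero, mem_univ], ?_⟩
      exact ClusterPt.mono (ClusterPt.of_le_nhds (pure_le_nhds (f w)))
        (map_pure f w ▸ map_mono (pure_le_nhds w))
    · obtain ⟨z, hzw, hz⟩ := ih σ σ.2 hσ hw hwσ
      exact ⟨z, hz, hzw.mono (map_mono nhdsWithin_le_nhds)⟩
  obtain ⟨y, hyx, hy⟩ := hf.exists_mapClusterPt_forall_mem_derivedSet
    (D := fun σ : Iio ρ => cbDerivative Y (σ : Ordinal))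
    (fun σ τ hστ => cbDerivative_antitone hστ) hx hfreq
  exact ⟨y, hyx, mem_cbDerivative_iff.2 fun σ hσ => hy ⟨σ, hσ⟩⟩

end IsKatetovReduction

end Reductions

theorem exists_strictMono_seq_of_isSuccLimit {ι : Type*} [LinearOrder ι] [TopologicalSpace ι]
    [OrderTopology ι] {a o : ι} [(𝓝 o).IsCountablyGenerated] (ho : Order.IsSuccLimit o)
    (ha : a < o) :
    ∃ e : ℕ → ι, StrictMono e ∧ (∀ n, a ≤ e n ∧ e n < o) ∧ ∀ b < o, ∃ n, b < e n := by
  obtain ⟨e, he, heo, hetends, -⟩ := ho.isLUB_Iio.exists_seq_strictMono_tendsto_of_notMem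
    self_notMem_Iio ⟨a, ha⟩
  obtain ⟨N, hN⟩ := eventually_atTop.1 (hetends.eventually_const_le ha)
  refine ⟨fun n => e (n + N), he.comp (strictMono_id.add_const N),
    fun n => ⟨hN _ (Nat.le_add_left _ _), heo _⟩, fun b hb => ?_⟩
  exact ((hetends.comp (tendsto_add_atTop_nat N)).eventually_const_lt hb).exists

section Ordinals

variable {a o x ρ σ τ : Ordinal.{u}}

theorem mem_derivedSet_ordinal_iff {S : Set Ordinal.{u}} :
    o ∈ derivedSet S ↔ o ≠ 0 ∧ ∀ p < o, ∃ w ∈ S, p < w ∧ w < o := by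
  rw [mem_derivedSet, SuccOrder.accPt_principal]
  simp [Set.Nonempty]

theorem mem_derivedSet_setOf_dvd_iff (ha : a ≠ 0) :
    x ∈ derivedSet {w | a ∣ w} ↔ x ≠ 0 ∧ a * ω ∣ x := by
  have ha' : 0 < a := pos_iff_ne_zero.2 ha
  rw [mem_derivedSet_ordinal_iff]
  refine and_congr_right fun hx => ⟨fun h => ?_, ?_⟩
  · have hdvd : a * (x / a) = x := by
      refine (Ordinal.mul_div_le x a).eq_or_lt.resolve_right fun hlt => ?_
      obtain ⟨_, ⟨e, rfl⟩, hqe, hex⟩ := h _ hlt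
      have heq := lt_of_mul_lt_mul_left (hex.trans (Ordinal.lt_mul_succ_div x ha)) zero_le
      exact (Order.lt_succ_iff.1 heq).not_gt (lt_of_mul_lt_mul_left hqe zero_le)
    rw [← hdvd]
    refine mul_dvd_mul_left a (Ordinal.isSuccPrelimit_iff_omega0_dvd.1 ?_)
    refine Order.isSuccPrelimit_of_succ_ne fun e he => ?_
    rw [← hdvd, ← he] at h
    obtain ⟨_, ⟨d, rfl⟩, hed, hde⟩ := h _ (mul_lt_mul_of_pos_left (Order.lt_succ e) ha')
    exact (Order.lt_succ_iff.1 (lt_of_mul_lt_mul_left hde zero_le)).not_gt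
      (lt_of_mul_lt_mul_left hed zero_le)
  · rintro ⟨q, rfl⟩ p hp
    rw [mul_assoc] at hp hx ⊢
    have hq : 0 < q := pos_iff_ne_zero.2 (right_ne_zero_of_mul (right_ne_zero_of_mul hx))
    obtain ⟨c, hc, hpc⟩ := (Ordinal.lt_mul_iff_of_isSuccLimit
      (Ordinal.isSuccLimit_mul_left Ordinal.isSuccLimit_omega0 hq)).1 hp
    exact ⟨_, dvd_mul_right a c, hpc, mul_lt_mul_of_pos_left hc ha'⟩

theorem omega0_opow_dvd_of_isSuccLimit (hρ : Order.IsSuccLimit ρ) (h : ∀ σ < ρ, ω ^ σ ∣ x) :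
    ω ^ ρ ∣ x := by
  rw [Ordinal.dvd_iff_mod_eq_zero]
  by_contra hmod
  obtain ⟨σ, hσ, hlt⟩ := (Ordinal.lt_opow_of_isSuccLimit Ordinal.omega0_ne_zero hρ).1
    (Ordinal.mod_lt x (Ordinal.opow_pos ρ Ordinal.omega0_pos).ne')
  have hdvd := h σ hσ
  rw [← Ordinal.div_add_mod x (ω ^ ρ),
    Ordinal.dvd_add_iff ((Ordinal.opow_dvd_opow ω hσ.le).mul_right _)] at hdvd
  exact (Ordinal.le_of_dvd hmod hdvd).not_gt hlt

theorem omega0_opow_dvd_iff_forall_lt : ω ^ ρ ∣ x ↔ ∀ σ < ρ, ω ^ (σ + 1) ∣ x := by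
  refine ⟨fun h σ hσ => (Ordinal.opow_dvd_opow ω (Order.add_one_le_of_lt hσ)).trans h,
    fun h => ?_⟩
  rcases Ordinal.zero_or_succ_or_isSuccLimit ρ with rfl | ⟨σ, rfl⟩ | hρ
  · simp
  · exact h σ (Order.lt_succ σ)
  · exact omega0_opow_dvd_of_isSuccLimit hρ fun σ hσ =>
      (Ordinal.opow_dvd_opow ω (Order.le_succ σ)).trans (h σ hσ)

theorem mem_cbDerivative_ordinal_iff (hx : x ≠ 0) :
    x ∈ cbDerivative Ordinal.{u} ρ ↔ ω ^ ρ ∣ x := by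
  induction ρ using WellFoundedLT.induction generalizing x with
  | ind ρ ih =>
  rw [mem_cbDerivative_iff, omega0_opow_dvd_iff_forall_lt]
  refine forall₂_congr fun σ hσ => ?_
  calc x ∈ derivedSet (cbDerivative Ordinal σ)
      ↔ x ∈ derivedSet {w | ω ^ σ ∣ w} := by
        simp only [mem_derivedSet_ordinal_iff]
        exact and_congr_right fun _ => forall₂_congr fun p _ => exists_congr fun w =>
          and_congr_left fun hw => ih σ hσ hw.1.ne_bot
    _ ↔ ω ^ (σ + 1) ∣ x := by
        rw [mem_derivedSet_setOf_dvd_iff (Ordinal.opow_pos σ Ordinal.omega0_pos).ne',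
          Ordinal.opow_add, Ordinal.opow_one]
        exact and_iff_right hx

theorem omega0_opow_le_of_mem_cbDerivative (hρ : ρ ≠ 0) (hx : x ∈ cbDerivative Ordinal.{u} ρ) :
    ω ^ ρ ≤ x := by
  have hx0 : x ≠ 0 :=
    (mem_derivedSet_ordinal_iff.1 (mem_cbDerivative_iff.1 hx 0 (pos_iff_ne_zero.2 hρ))).1
  exact Ordinal.le_of_dvd hx0 ((mem_cbDerivative_ordinal_iff hx0).1 hx)

theorem infinite_cbDerivative_ordinal_inter_Iio (h : σ < τ) :
    (cbDerivative Ordinal.{u} σ ∩ Iio (ω ^ τ)).Infinite := by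
  have hσ : 0 < ω ^ σ := Ordinal.opow_pos σ Ordinal.omega0_pos
  refine (infinite_range_of_injective (f := fun n : ℕ => ω ^ σ * ((n + 1 : ℕ) : Ordinal.{u}))
    fun m n hmn => ?_).mono ?_
  · simpa using mul_left_cancel₀ hσ.ne' hmn
  · rintro _ ⟨n, rfl⟩
    refine ⟨(mem_cbDerivative_ordinal_iff (mul_ne_zero hσ.ne' (by simp))).2
      (dvd_mul_right _ _), ?_⟩
    exact Ordinal.opow_mul_lt_opow (Ordinal.natCast_lt_omega0 (n + 1)) h

theorem Iio_omega0_opow_two_notMem_convFamily :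
    Iio (ω ^ (2 : Ordinal.{u})) ∉ convFamily Ordinal := by
  refine fun h => (infinite_cbDerivative_ordinal_inter_Iio one_lt_two).mono ?_
    (finite_derivedSet_of_mem_convFamily h)
  rintro x ⟨hx, hx2⟩
  have hx01 := mem_cbDerivative_iff.1 hx 0 zero_lt_one
  rw [cbDerivative_zero] at hx01
  simpa using AccPt.nhds_inter hx01 (isOpen_Iio.mem_nhds hx2)

theorem isCountablyGenerated_nhds_of_lt_omega_one (ho : o < ω₁) : (𝓝 o).IsCountablyGenerated := by
  have hcount : (Iio o).Countable := by
    rw [← Cardinal.le_aleph0_iff_set_countable, Cardinal.mk_Iio_ordinal, Cardinal.lift_le_aleph0]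
    exact Cardinal.lt_aleph_one_iff.1 (Cardinal.lt_ord.1 (Cardinal.ord_aleph 1 ▸ ho))
  by_cases h0 : IsMin o
  · rw [SuccOrder.nhds_of_isMin h0]
    infer_instance
  · exact HasCountableBasis.isCountablyGenerated
      ⟨SuccOrder.hasBasis_nhds_Ioc_of_exists_lt (not_isMin_iff.1 h0), hcount⟩

end Ordinals

section ConvLT

variable {α β : Ordinal.{u}}

theorem mem_Iio_omega0_opow_add_one_iff {x : Ordinal.{u}} : x ∈ Iio (ω ^ β + 1) ↔ x ≤ ω ^ β :=
  mem_Iio.trans Order.lt_add_one_iff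

theorem Iio_omega0_opow_add_one_mono :
    Monotone fun β : Ordinal.{u} => Iio (ω ^ β + 1) := fun _ _ h =>
  Iio_subset_Iio (add_le_add_left (Ordinal.opow_le_opow_right Ordinal.omega0_pos h) 1)

instance compactSpace_omegaPowSucc : CompactSpace (OmegaPowSucc α) := by
  have hIcc : Iio (ω ^ α + 1) = Icc 0 (ω ^ α) :=
    ext fun x => mem_Iio_omega0_opow_add_one_iff.trans (and_iff_right zero_le).symm
  rw [← isCompact_iff_compactSpace, hIcc]
  exact isCompact_Icc

theorem firstCountableTopology_omegaPowSucc (hα : α < ω₁) :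
    FirstCountableTopology (OmegaPowSucc α) := by
  refine ⟨fun x => ?_⟩
  have hx : (x : Ordinal) < ω₁ := (mem_Iio_omega0_opow_add_one_iff.1 x.2).trans_lt
    (Ordinal.isPrincipal_opow_omega 1 Ordinal.omega0_lt_omega_one hα)
  have := isCountablyGenerated_nhds_of_lt_omega_one hx
  rw [nhds_subtype]
  infer_instance

/-- The retraction of the ordinals onto `ω ^ β + 1` which sends all larger ordinals to the last
point `ω ^ β`. -/
noncomputable def omegaPowSuccRetraction (β x : Ordinal.{u}) : OmegaPowSucc β :=
  ⟨min x (ω ^ β), mem_Iio_omega0_opow_add_one_iff.2 (min_le_right _ _)⟩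

theorem continuous_omegaPowSuccRetraction (β : Ordinal.{u}) :
    Continuous (omegaPowSuccRetraction β) :=
  (continuous_id.min continuous_const).subtype_mk _

theorem omegaPowSuccRetraction_coe (x : OmegaPowSucc β) : omegaPowSuccRetraction β x = x :=
  Subtype.ext (min_eq_left (mem_Iio_omega0_opow_add_one_iff.1 x.2))

theorem coe_omegaPowSuccRetraction {x : Ordinal.{u}} (hx : x ≤ ω ^ β) :
    (omegaPowSuccRetraction β x : Ordinal) = x :=
  min_eq_left hx

theorem mem_convOrd_iff {A : Set (OmegaPowSucc β)} :
    A ∈ convOrd β ↔ ((↑) : OmegaPowSucc β → Ordinal) '' A ∈ convFamily Ordinal :=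
  (image_mem_convFamily_iff continuous_subtype_val (continuous_omegaPowSuccRetraction β)
    omegaPowSuccRetraction_coe).symm

theorem mem_convLT_iff {A : Set (OmegaPowSucc α)} :
    A ∈ convLT α ↔ ∀ β : Ordinal.{u}, 2 ≤ β → β < α →
      ((↑) : OmegaPowSucc α → Ordinal) '' A ∩ Iio (ω ^ β) ∈ convFamily Ordinal := by
  refine forall₃_congr fun β _ _ => ?_
  rw [mem_convOrd_iff, Subtype.image_preimage_coe, inter_eq_self_of_subset_right]
  exact fun x hx => mem_Iio_omega0_opow_add_one_iff.2 (le_of_lt hx.2)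

theorem convOrd_subset_convLT (α : Ordinal.{u}) : convOrd α ⊆ convLT α := fun _ hA =>
  mem_convLT_iff.2 fun _ _ _ => mem_convFamily_of_subset (mem_convOrd_iff.1 hA) inter_subset_left

theorem katetovLE_convLT_convOrd (h2 : 2 ≤ β) (hβ : β < α) :
    KatetovLE (convLT α) (convOrd β) := by
  refine ⟨inclusion (Iio_omega0_opow_add_one_mono hβ.le), fun A hA => mem_convOrd_iff.2 ?_⟩
  refine mem_convFamily_of_subset
    (union_mem_convFamily (mem_convLT_iff.1 hA β h2 hβ) (singleton_mem_convFamily (ω ^ β))) ?_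
  rintro _ ⟨x, hx, rfl⟩
  exact (mem_Iio_omega0_opow_add_one_iff.1 x.2).lt_or_eq.imp (fun h => ⟨⟨_, hx, rfl⟩, h⟩) id

theorem univ_notMem_convLT (h2 : 2 < α) : univ ∉ convLT α := fun h => by
  refine Iio_omega0_opow_two_notMem_convFamily
    (mem_convFamily_of_subset (mem_convLT_iff.1 h 2 le_rfl h2) fun x hx => ⟨?_, hx⟩)
  rw [image_univ, Subtype.range_coe]
  exact Iio_omega0_opow_add_one_mono h2.le (mem_Iio_omega0_opow_add_one_iff.2 (le_of_lt hx))

theorem isIdealOn_convLT (h2 : 2 < α) : IsIdealOn (convLT α) where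
  empty_mem := convOrd_subset_convLT α empty_mem_convFamily
  univ_notMem := univ_notMem_convLT h2
  union_mem A B hA hB := mem_convLT_iff.2 fun β h2 hβ => by
    rw [image_union, union_inter_distrib_right]
    exact union_mem_convFamily (mem_convLT_iff.1 hA β h2 hβ) (mem_convLT_iff.1 hB β h2 hβ)
  subset_mem A B hAB hB := mem_convLT_iff.2 fun β h2 hβ =>
    mem_convFamily_of_subset (mem_convLT_iff.1 hB β h2 hβ)
      (inter_subset_inter_left _ (image_mono hAB))
  finite_mem A hA := convOrd_subset_convLT α (finite_mem_convFamily hA)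

theorem katetovLE_convLT_of_forall [(𝓝 α).IsCountablyGenerated] (hα : Order.IsSuccLimit α)
    {Y : Type*} {I : Set (Set Y)}
    (h : ∀ β : Ordinal.{u}, 2 ≤ β → β < α → KatetovLE I (convOrd β)) :
    KatetovLE I (convLT α) := by
  obtain ⟨e, -, heα, he⟩ := exists_strictMono_seq_of_isSuccLimit hα
    (show 2 < α from mod_cast Ordinal.natCast_lt_of_isSuccLimit hα 2)
  choose f hf using fun n => h (e n) (heα n).1 (heα n).2
  -- A point below `ω ^ α` is mapped by the first `f n` whose domain has it below the last point.
  let level (x : Ordinal.{u}) : ℕ := sInf {n | x < ω ^ e n}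
  refine ⟨fun x => f (level x) (omegaPowSuccRetraction (e (level x)) x),
    fun A hA => mem_convLT_iff.2 fun β _ hβ => ?_⟩
  obtain ⟨m, hm⟩ := he β hβ
  refine mem_convFamily_of_subset (biUnion_mem_convFamily (finite_Iic m)
    fun n _ => mem_convOrd_iff.1 (hf n A hA)) ?_
  rintro _ ⟨⟨x, hx, rfl⟩, hxβ⟩
  have hxm : (x : Ordinal) < ω ^ e m :=
    hxβ.trans_le (Ordinal.opow_le_opow_right Ordinal.omega0_pos hm.le)
  have hlevel : (x : Ordinal) < ω ^ e (level x) := Nat.sInf_mem (s := {n | _ < ω ^ e n}) ⟨m, hxm⟩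
  exact mem_iUnion₂.2 ⟨level x, Nat.sInf_le hxm, _, hx, coe_omegaPowSuccRetraction hlevel.le⟩

theorem iUnion_range_mem_convLT {e : ℕ → Ordinal.{u}} (he : Monotone e)
    (heα : ∀ β < α, ∃ n, β < e n) {t : ℕ → ℕ → OmegaPowSucc α} {y : ℕ → OmegaPowSucc α}
    (ht : ∀ n, Tendsto (t n) atTop (𝓝 (y n))) (hte : ∀ n k, ω ^ e n < (t n k : Ordinal)) :
    ⋃ n, range (t n) ∈ convLT α := by
  refine mem_convLT_iff.2 fun β _ hβ => ?_
  obtain ⟨m, hm⟩ := heα β hβ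
  refine mem_convFamily_of_subset (biUnion_mem_convFamily (finite_Iio m) fun n _ =>
    image_mem_convFamily continuous_subtype_val (range_mem_convFamily (ht n))) ?_
  rintro _ ⟨⟨z, hz, rfl⟩, hzβ⟩
  obtain ⟨n, k, rfl⟩ := mem_iUnion.1 hz
  refine mem_iUnion₂.2 ⟨n, mem_Iio.2 (not_le.1 fun hmn => (mem_Iio.1 hzβ).not_ge ?_),
    _, ⟨k, rfl⟩, rfl⟩
  calc ω ^ β ≤ ω ^ e n := Ordinal.opow_le_opow_right Ordinal.omega0_pos (hm.le.trans (he hmn))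
    _ ≤ t n k := (hte n k).le

end ConvLT

theorem exists_injective_forall_mem_of_infinite {X : Type*} {S : ℕ → Set X}
    (hS : ∀ n, (S n).Infinite) : ∃ x : ℕ → X, Function.Injective x ∧ ∀ n, x n ∈ S n := by
  classical
  choose t htS ht using fun n => (hS n).exists_subset_card_eq (n + 1)
  have hall (s : Finset ℕ) : s.card ≤ (s.biUnion t).card := by
    rcases s.eq_empty_or_nonempty with rfl | hs
    · simp
    calc s.card ≤ (Finset.range (s.max' hs + 1)).card := Finset.card_le_card fun n hn =>
          Finset.mem_range.2 (Order.lt_add_one_iff.2 (s.le_max' n hn))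
      _ = (t (s.max' hs)).card := by rw [Finset.card_range, ht]
      _ ≤ (s.biUnion t).card :=
          Finset.card_le_card (Finset.subset_biUnion_of_mem t (s.max'_mem hs))
  obtain ⟨x, hx, hxt⟩ := (Finset.all_card_le_biUnion_card_iff_exists_injective t).1 hall
  exact ⟨x, hx, fun n => htS n (hxt n)⟩

section NotReducible

variable {X : Type*} [TopologicalSpace X] [T2Space X] [FirstCountableTopology X]
  {α : Ordinal.{u}}

theorem exists_finite_setOf_mapClusterPt_gt (hα : Order.IsSuccLimit α) (hcount : α < ω₁)
    {f : X → OmegaPowSucc α} (hf : IsKatetovReduction f (convLT α) (convFamily X)) :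
    ∃ β < α, {x | ∃ y, MapClusterPt y (𝓝[≠] x) f ∧ ω ^ β < (y : Ordinal)}.Finite := by
  have := firstCountableTopology_omegaPowSucc hcount
  have := isCountablyGenerated_nhds_of_lt_omega_one hcount
  obtain ⟨e, he, heα, hβe⟩ := exists_strictMono_seq_of_isSuccLimit hα hα.bot_lt
  by_contra! hinf
  obtain ⟨x, hx, hxS⟩ :=
    exists_injective_forall_mem_of_infinite fun n => hinf (e n) (heα n).2
  choose y hxy hy using hxS
  obtain ⟨t, ht, hte, htX⟩ := exists_seq_preimage_iUnion_range_notMem_convFamily hx hxy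
    fun n => (isOpen_Ioi.preimage continuous_subtype_val).mem_nhds (hy n)
  exact htX (hf _ (iUnion_range_mem_convLT he.monotone hβe ht hte))

theorem not_katetovLE_convLT_convFamily (hα : Order.IsSuccLimit α) (hcount : α < ω₁)
    (hX : ∀ ρ < α, (cbDerivative X ρ).Infinite) : ¬ KatetovLE (convLT α) (convFamily X) := by
  rintro ⟨f, hf : IsKatetovReduction f (convLT α) (convFamily X)⟩
  have := firstCountableTopology_omegaPowSucc hcount
  have hconv : IsKatetovReduction f (convFamily (OmegaPowSucc α)) (convFamily X) :=
    fun A hA => hf A (convOrd_subset_convLT α hA)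
  obtain ⟨β, hβ, hfin⟩ := exists_finite_setOf_mapClusterPt_gt hα hcount hf
  obtain ⟨x, hxβ, hx⟩ := (hX (β + 1) (hα.add_one_lt hβ)).exists_notMem_finite
    (hconv.finite_fiberAccPts.union hfin)
  rw [mem_union, not_or] at hx
  obtain ⟨y, hxy, hy⟩ := hconv.exists_mapClusterPt_mem_cbDerivative (by simp) hx.1 hxβ
  refine hx.2 ⟨y, hxy, ?_⟩
  rw [← preimage_cbDerivative_of_isOpenEmbedding isOpen_Iio.isOpenEmbedding_subtypeVal] at hy
  calc ω ^ β < ω ^ (β + 1) :=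
        (Ordinal.opow_lt_opow_iff_right Ordinal.one_lt_omega0).2 (lt_add_one β)
    _ ≤ y := omega0_opow_le_of_mem_cbDerivative (by simp) hy

end NotReducible

theorem infinite_cbDerivative_omegaPowSucc {ρ α : Ordinal.{u}} (h : ρ < α) :
    (cbDerivative (OmegaPowSucc α) ρ).Infinite := by
  rw [← preimage_cbDerivative_of_isOpenEmbedding isOpen_Iio.isOpenEmbedding_subtypeVal]
  refine Infinite.of_image Subtype.val ?_
  rw [Subtype.image_preimage_coe]
  exact (infinite_cbDerivative_ordinal_inter_Iio h).mono fun x hx =>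
    ⟨mem_Iio_omega0_opow_add_one_iff.2 (le_of_lt hx.2), hx.1⟩

theorem not_katetovLE_convLT_convOrd {α : Ordinal.{u}} (hα : Order.IsSuccLimit α)
    (hcount : α < ω₁) : ¬ KatetovLE (convLT α) (convOrd α) := by
  have := firstCountableTopology_omegaPowSucc hcount
  exact not_katetovLE_convLT_convFamily hα hcount fun ρ => infinite_cbDerivative_omegaPowSucc

theorem mainTheorem1 (α : Ordinal.{u}) (hα : Order.IsSuccLimit α) (hcount : α < ω₁) :
    -- `conv_{<α}` is an ideal
    IsIdealOn (convLT α) ∧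
    -- it is a lower bound of the `conv_β`, `2 ≤ β < α`
    (∀ β : Ordinal.{u}, 2 ≤ β → β < α → KatetovLE (convLT α) (convOrd β)) ∧
    -- it is above every lower bound
    (∀ (Y : Type v) (I : Set (Set Y)), IsIdealOn I →
      (∀ β : Ordinal.{u}, 2 ≤ β → β < α → KatetovLE I (convOrd β)) →
        KatetovLE I (convLT α)) ∧
    -- it is strictly above `conv_α`
    KatetovLE (convOrd α) (convLT α) ∧
    ¬ KatetovLE (convLT α) (convOrd α) ∧
    -- hence `conv_α` is not a greatest lower bound
    ¬ (∀ (Y : Type (u + 1)) (I : Set (Set Y)), IsIdealOn I →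
      (∀ β : Ordinal.{u}, 2 ≤ β → β < α → KatetovLE I (convOrd β)) →
        KatetovLE I (convOrd α)) := by
  have h2 : 2 < α := mod_cast Ordinal.natCast_lt_of_isSuccLimit hα 2
  have := isCountablyGenerated_nhds_of_lt_omega_one hcount
  have hnot := not_katetovLE_convLT_convOrd hα hcount
  exact ⟨isIdealOn_convLT h2, fun β => katetovLE_convLT_convOrd,
    fun Y I _ h => katetovLE_convLT_of_forall hα h, ⟨id, convOrd_subset_convLT α⟩, hnot,
    fun h => hnot (h _ _ (isIdealOn_convLT h2) fun β => katetovLE_convLT_convOrd)⟩
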